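/- Let $n\in\mathbb N$, regard $n\times n$ matrices as vectors in $\mathbb R^{n^2}$ with the Euclidean (Frobenius) norm, let $\mathcal B$ be the Birkhoff polytope (the set of doubly stochastic matrices) and $\mathcal P\subset\mathcal B$ the set of permutation matrices. Let $x^\star\in\mathcal B$ and $f(x)=\tfrac12\|x-x^\star\|_2^2$. Fully corrective Frank–Wolfe with tolerance $\varepsilon_0\ge 0$ starts from an arbitrary $x_0\in\mathcal P$ with no stored atoms and, for $k=1,2,\dots$, as long as $\|x_{k-1}-x^\star\|_2>\varepsilon_0$, chooses $$p_k\in\mathcal P\cap\operatorname*{arg\,min}_{u\in\mathcal B}\langle\nabla f(x_{k-1}),u\rangle,\qquad (\theta_1,\dots,\theta_k)\in\operatorname*{arg\,min}_{u\ge 0,\ \sum_i u_i=1}\Big\|\sum_{i=1}^k u_ip_i-x^\star\Big\|_2^2,\qquad x_k=\sum_{i=1}^k\theta_ip_i .$$ An $\varepsilon$-approximate decomposition of $x^\star$ consists of permutation matrices $P_i$ and weights $w_i>0$ with $\sum_i w_i\le 1$ and $\|x^\star-\sum_i w_iP_i\|_2\le\varepsilon$. Then: (1) For every run and every computed iterate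 $x_k$, put $\varepsilon=\|x_k-x^\star\|_2$. If $k\ge1$, the permutations $p_1,\dots,p_k$ with those of the weights $\theta_1,\dots,\theta_k$ that are positive form an $\varepsilon$-approximate decomposition of $x^\star$. If $\varepsilon>0$ (and, in the case $k=1$, if moreover $\|x_1-x^\star\|_2\le\|x_0-x^\star\|_2$, which holds whenever the algorithm stops at $k=1$ because the tolerance is met), then $$k\le 8n^3\log\!\big(2n/\varepsilon^2\big).$$ (2) For every tolerance $\varepsilon>0$: from every starting point $x_0\in\mathcal P$ there is a run that reaches $\|x_k-x^\star\|_2\le\varepsilon$, and every run with tolerance $\varepsilon$ has at most $\max\{1,\,8n^3\log(2n/\varepsilon^2)\}$ iterations. -/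

import Mathlib

noncomputable section

namespace FCFW

/-- `ℝ^d` with `d = n²`, coordinates indexed by matrix positions, with the Euclidean norm
(which is the Frobenius norm of the matrix). -/
abbrev Vec (n : ℕ) : Type := EuclideanSpace ℝ (Fin n × Fin n)

/-- The vector form of an `n × n` matrix. -/
def vec {n : ℕ} (X : Matrix (Fin n) (Fin n) ℝ) : Vec n :=
  WithLp.toLp 2 (fun ij => X ij.1 ij.2)

/-- The Birkhoff polytope: doubly stochastic matrices in vector form. -/
def birkhoff (n : ℕ) : Set (Vec n) :=
  vec '' (doublyStochastic ℝ (Fin n) : Set (Matrix (Fin n) (Fin n) ℝ))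

/-- The permutation matrices in vector form. -/
def perms (n : ℕ) : Set (Vec n) :=
  Set.range fun σ : Equiv.Perm (Fin n) => vec (σ.permMatrix ℝ)

/-- The objective `f(x) = (1/2) ‖x - x⋆‖²`. -/
def objective {n : ℕ} (xstar x : Vec n) : ℝ := (1 / 2) * ‖x - xstar‖ ^ 2

/-- `p` may be returned by the linear program "minimize `⟨c, u⟩` over `u` in the Birkhoff
polytope": it is a minimizer and it is a permutation matrix (an extreme point). -/
def IsLPSolution {n : ℕ} (c p : Vec n) : Prop :=
  p ∈ perms n ∧ IsMinOn (fun u : Vec n => inner ℝ c u) (birkhoff n) p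

/-- The product `V_k u`, where the columns of `V_k` are `p 1, …, p k`. -/
def combine {n : ℕ} (p : ℕ → Vec n) (k : ℕ) (u : Fin k → ℝ) : Vec n :=
  ∑ i : Fin k, u i • p (i + 1)

/-- `x 0, …, x K`, `p 1, …, p K` and `θ 1, …, θ K` (with `θ k` the weight vector computed in
iteration `k`) are the data produced by the first `K` iterations of fully corrective Frank-Wolfe
with target `xstar` and tolerance `tol`, started with no stored atoms. The algorithm need not
have stopped after `K` iterations, so that every cap on the number of iterations is covered. -/
structure IsRun {n : ℕ} (xstar : Vec n) (tol : ℝ) (K : ℕ)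
    (x p : ℕ → Vec n) (θ : (k : ℕ) → Fin k → ℝ) : Prop where
  /-- The starting point is a permutation matrix. -/
  init : x 0 ∈ perms n
  /-- An iteration is executed only while the error exceeds the tolerance. -/
  guard : ∀ k < K, tol < ‖x k - xstar‖
  /-- The new permutation solves the linear program given by the gradient. -/
  lp : ∀ k < K, IsLPSolution (gradient (objective xstar) (x k)) (p (k + 1))
  /-- The weights are taken in the simplex, -/
  simplex : ∀ k < K, θ (k + 1) ∈ stdSimplex ℝ (Fin (k + 1))
  /-- and are optimal there. -/
  optimal : ∀ k < K, IsMinOn (fun u : Fin (k + 1) → ℝ => ‖combine p (k + 1) u - xstar‖ ^ 2)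
    (stdSimplex ℝ (Fin (k + 1))) (θ (k + 1))
  /-- The new iterate. -/
  iterate : ∀ k < K, x (k + 1) = combine p (k + 1) (θ (k + 1))

/-- The permutations `P i` with the positive weights `w i`, for `i ∈ S`, form an `ε`-approximate
decomposition of `xstar`. -/
def IsApproxDecomposition {n : ℕ} (xstar : Vec n) (ε : ℝ) {ι : Type*} (S : Finset ι)
    (P : ι → Vec n) (w : ι → ℝ) : Prop :=
  (∀ i ∈ S, P i ∈ perms n) ∧ (∀ i ∈ S, 0 < w i) ∧ ∑ i ∈ S, w i ≤ 1 ∧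
    ‖xstar - ∑ i ∈ S, w i • P i‖ ≤ ε

end FCFW

end

namespace FCFW

variable {n : ℕ}

/-! The heart is `norm_sub_le_mul_gap`: at a fully corrected iterate `x`, the Frank-Wolfe gap is at
least `‖x - x⋆‖ / n`. To move from `x` to `x⋆`, remove mass from the active permutations and put
back a nonnegative matrix `W` with constant line sums `s`. The excess of `x` over `x⋆` dictates the
mass removed, so `s ≤ ‖x - x⋆‖₁ ≤ n ‖x - x⋆‖`. Active atoms are no worse than `x` along the gradient
and `W / s` is no better than the LP vertex, so `‖x - x⋆‖² ≤ s · gap`.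

A step of length `gap / (2n)` towards the new atom is feasible for the correction and, the squared
diameter being at most `2n`, lowers the squared error by `gap² / (2n)`. Hence a contraction by `1 -
1/(2n³)`, started from `‖x 2 - x⋆‖² ≤ n/2`. Taking logarithms gives the count; runs with `K ≤ 2` are
treated through the errors at `x 0` and `x 1`. Runs can always be extended, so the count also forces
the tolerance to be reached. -/

theorem mem_birkhoff_iff {u : Vec n} : u ∈ birkhoff n ↔
    (∀ e, 0 ≤ u e) ∧ (∀ i, ∑ j, u (i, j) = 1) ∧ ∀ j, ∑ i, u (i, j) = 1 := by
  constructor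
  · rintro ⟨X, hX, rfl⟩
    obtain ⟨h0, h1, h2⟩ := mem_doublyStochastic_iff_sum.1 hX
    exact ⟨fun e => h0 e.1 e.2, h1, h2⟩
  · rintro ⟨h0, h1, h2⟩
    refine ⟨fun i j => u (i, j), mem_doublyStochastic_iff_sum.2 ⟨fun i j => h0 _, h1, h2⟩, ?_⟩
    ext e
    rfl

theorem perms_subset_birkhoff : perms n ⊆ birkhoff n := by
  rintro _ ⟨σ, rfl⟩
  exact ⟨_, permMatrix_mem_doublyStochastic, rfl⟩

theorem mul_self_apply_of_mem_perms {p : Vec n} (hp : p ∈ perms n) (e : Fin n × Fin n) :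
    p e * p e = p e := by
  obtain ⟨σ, rfl⟩ := hp
  simp only [vec, Equiv.Perm.permMatrix, PEquiv.toMatrix_apply]
  split_ifs <;> simp

theorem inner_eq_sum (u v : Vec n) : inner ℝ u v = ∑ e, u e * v e := by
  simp [PiLp.inner_apply, mul_comm]

theorem sum_apply_of_mem_birkhoff {u : Vec n} (hu : u ∈ birkhoff n) : ∑ e, u e = n := by
  rw [Fintype.sum_prod_type]
  simp [(mem_birkhoff_iff.1 hu).2.1]

theorem apply_le_one_of_mem_birkhoff {u : Vec n} (hu : u ∈ birkhoff n) (e : Fin n × Fin n) :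
    u e ≤ 1 := by
  obtain ⟨h0, h1, -⟩ := mem_birkhoff_iff.1 hu
  rw [← h1 e.1]
  exact Finset.single_le_sum (f := fun j => u (e.1, j)) (fun j _ => h0 _) (Finset.mem_univ e.2)

theorem inner_nonneg_of_mem_birkhoff {u v : Vec n} (hu : u ∈ birkhoff n) (hv : v ∈ birkhoff n) :
    0 ≤ inner ℝ u v := by
  rw [inner_eq_sum]
  exact Finset.sum_nonneg fun e _ =>
    mul_nonneg ((mem_birkhoff_iff.1 hu).1 e) ((mem_birkhoff_iff.1 hv).1 e)

theorem norm_sq_le_of_mem_birkhoff {u : Vec n} (hu : u ∈ birkhoff n) : ‖u‖ ^ 2 ≤ n := by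
  rw [← real_inner_self_eq_norm_sq, inner_eq_sum, ← sum_apply_of_mem_birkhoff hu]
  exact Finset.sum_le_sum fun e _ =>
    mul_le_of_le_one_left ((mem_birkhoff_iff.1 hu).1 e) (apply_le_one_of_mem_birkhoff hu e)

/-- The squared diameter of the Birkhoff polytope is at most `2n`. -/
theorem norm_sub_sq_le_of_mem_birkhoff {u v : Vec n} (hu : u ∈ birkhoff n)
    (hv : v ∈ birkhoff n) : ‖u - v‖ ^ 2 ≤ 2 * n := by
  rw [norm_sub_sq_real]
  linarith [norm_sq_le_of_mem_birkhoff hu, norm_sq_le_of_mem_birkhoff hv,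
    inner_nonneg_of_mem_birkhoff hu hv]

theorem convex_birkhoff : Convex ℝ (birkhoff n) := by
  intro u hu v hv a b ha hb hab
  obtain ⟨h0, h1, h2⟩ := mem_birkhoff_iff.1 hu
  obtain ⟨k0, k1, k2⟩ := mem_birkhoff_iff.1 hv
  refine mem_birkhoff_iff.2 ⟨fun e => ?_, fun i => ?_, fun j => ?_⟩
  · exact add_nonneg (mul_nonneg ha (h0 e)) (mul_nonneg hb (k0 e))
  · simp [Finset.sum_add_distrib, ← Finset.mul_sum, h1, k1, hab]
  · simp [Finset.sum_add_distrib, ← Finset.mul_sum, h2, k2, hab]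

/-! ### Lower bound for the Frank-Wolfe gap -/

/-- Minimality over the Birkhoff polytope extends to the cone it spans. -/
theorem mul_inner_le_of_lineSums {c v W : Vec n} {s : ℝ}
    (hv : ∀ u ∈ birkhoff n, inner ℝ c v ≤ inner ℝ c u) (h0 : ∀ e, 0 ≤ W e)
    (h1 : ∀ i, ∑ j, W (i, j) = s) (h2 : ∀ j, ∑ i, W (i, j) = s) (hs : 0 ≤ s) :
    s * inner ℝ c v ≤ inner ℝ c W := by
  rcases hs.eq_or_lt with rfl | hs
  · have hW : W = 0 := by
      ext e
      exact (Finset.sum_eq_zero_iff_of_nonneg (f := fun j => W (e.1, j)) fun j _ => h0 _).1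
        (h1 e.1) e.2 (Finset.mem_univ _)
    simp [hW]
  · have hmem : s⁻¹ • W ∈ birkhoff n := by
      refine mem_birkhoff_iff.2 ⟨fun e => ?_, fun i => ?_, fun j => ?_⟩
      · exact mul_nonneg (inv_nonneg.2 hs.le) (h0 e)
      · simp [← Finset.mul_sum, h1, hs.ne']
      · simp [← Finset.mul_sum, h2, hs.ne']
    have := hv _ hmem
    rw [inner_smul_right] at this
    calc s * inner ℝ c v ≤ s * (s⁻¹ * inner ℝ c W) := by gcongr
      _ = _ := by field_simp

theorem sum_abs_apply_le (g : Vec n) : ∑ e, |g e| ≤ n * ‖g‖ := by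
  refine abs_le_of_sq_le_sq' ?_ (by positivity) |>.2
  have h := sq_sum_le_card_mul_sum_sq (s := Finset.univ) (f := fun e => |g e|)
  rw [mul_pow, ← real_inner_self_eq_norm_sq, inner_eq_sum]
  simpa [← sq] using h

/-- If `x` is a convex combination of permutation matrices whose active atoms do not exceed `x`
in the direction `x - y`, then the Frank-Wolfe gap at `x` is at least `‖x - y‖ / n`. -/
theorem norm_sub_le_mul_gap {ι : Type*} [Fintype ι] {x y v : Vec n} {q : ι → Vec n} {θ : ι → ℝ}
    (hy : y ∈ birkhoff n) (hq : ∀ i, q i ∈ perms n) (hθ : θ ∈ stdSimplex ℝ ι)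
    (hx : x = ∑ i, θ i • q i) (hv : ∀ u ∈ birkhoff n, inner ℝ (x - y) v ≤ inner ℝ (x - y) u)
    (hact : ∀ i, 0 < θ i → inner ℝ (x - y) (q i) ≤ inner ℝ (x - y) x) :
    ‖x - y‖ ≤ n * inner ℝ (x - y) (x - v) := by
  have hqB : ∀ i, q i ∈ birkhoff n := fun i => perms_subset_birkhoff (hq i)
  have hxB : x ∈ birkhoff n := by
    rw [hx]
    exact convex_birkhoff.sum_mem (fun i _ => hθ.1 i) hθ.2 fun i _ => hqB i
  have hxe : ∀ e, x e = ∑ i, θ i * q i e := fun e => by simp [hx]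
  have hx0 := (mem_birkhoff_iff.1 hxB).1
  have hy0 := (mem_birkhoff_iff.1 hy).1
  have hq0 : ∀ i e, 0 ≤ q i e := fun i => (mem_birkhoff_iff.1 (hqB i)).1
  -- The fraction of entry `e` to remove. Where `x e = 0` the quotient is `0`, which is right
  -- because `y e ≥ 0` leaves no excess there.
  let r : Fin n × Fin n → ℝ := fun e => max 0 (x e - y e) / x e
  have hr0 : ∀ e, 0 ≤ r e := fun e => div_nonneg (le_max_left _ _) (hx0 e)
  have hrx : ∀ e, r e * x e = max 0 (x e - y e) := fun e => by
    rcases (hx0 e).eq_or_lt with h | h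
    · simp [r, ← h, hy0 e]
    · exact div_mul_cancel₀ _ h.ne'
  -- Atom `i` is charged for every entry of its support, so the total charge is exactly the total
  -- excess.
  let Δ : ι → ℝ := fun i => θ i * ∑ e, q i e * r e
  have hΔ0 : ∀ i, 0 ≤ Δ i := fun i =>
    mul_nonneg (hθ.1 i) (Finset.sum_nonneg fun e _ => mul_nonneg (hq0 i e) (hr0 e))
  have hΔ : ∑ i, Δ i = ∑ e, max 0 (x e - y e) := by
    simp only [Δ, Finset.mul_sum]
    rw [Finset.sum_comm]
    refine Finset.sum_congr rfl fun e _ => ?_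
    rw [← hrx, hxe, Finset.mul_sum]
    exact Finset.sum_congr rfl fun i _ => by ring
  have hΔle : ∑ i, Δ i ≤ n * ‖x - y‖ := by
    rw [hΔ]
    refine le_trans (Finset.sum_le_sum fun e _ => ?_) (sum_abs_apply_le (x - y))
    exact max_le (abs_nonneg _) (le_abs_self _)
  let W : Vec n := y - x + ∑ i, Δ i • q i
  have hWe : ∀ e, W e = y e - x e + ∑ i, Δ i * q i e := fun e => by simp [W]
  have hW0 : ∀ e, 0 ≤ W e := fun e => by
    have h : r e * x e ≤ ∑ i, Δ i * q i e := by
      rw [hxe, Finset.mul_sum]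
      refine Finset.sum_le_sum fun i _ => ?_
      have h1 : q i e * r e ≤ ∑ e', q i e' * r e' :=
        Finset.single_le_sum (f := fun e' => q i e' * r e')
          (fun e' _ => mul_nonneg (hq0 i e') (hr0 e')) (Finset.mem_univ e)
      -- Entries of `q i` are `0` or `1`, so a factor `q i e` can be duplicated.
      calc r e * (θ i * q i e) = θ i * (q i e * r e) * q i e := by
            linear_combination (-r e * θ i) * mul_self_apply_of_mem_perms (hq i) e
        _ ≤ _ := mul_le_mul_of_nonneg_right (mul_le_mul_of_nonneg_left h1 (hθ.1 i)) (hq0 i e)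
    rw [hrx] at h
    rw [hWe]
    linarith [le_max_right 0 (x e - y e)]
  have hW1 : ∀ i, ∑ j, W (i, j) = ∑ i, Δ i := fun i => by
    simp only [hWe, Finset.sum_add_distrib, Finset.sum_sub_distrib]
    rw [(mem_birkhoff_iff.1 hy).2.1, (mem_birkhoff_iff.1 hxB).2.1, Finset.sum_comm]
    simp [← Finset.mul_sum, (mem_birkhoff_iff.1 (hqB _)).2.1]
  have hW2 : ∀ j, ∑ i, W (i, j) = ∑ i, Δ i := fun j => by
    simp only [hWe, Finset.sum_add_distrib, Finset.sum_sub_distrib]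
    rw [(mem_birkhoff_iff.1 hy).2.2, (mem_birkhoff_iff.1 hxB).2.2, Finset.sum_comm]
    simp [← Finset.mul_sum, (mem_birkhoff_iff.1 (hqB _)).2.2]
  have hWv := mul_inner_le_of_lineSums hv hW0 hW1 hW2 (Finset.sum_nonneg fun i _ => hΔ0 i)
  have hatoms : ∑ i, Δ i * inner ℝ (x - y) (q i) ≤ (∑ i, Δ i) * inner ℝ (x - y) x := by
    rw [Finset.sum_mul]
    refine Finset.sum_le_sum fun i _ => ?_
    rcases (hθ.1 i).eq_or_lt with h | h
    · simp [Δ, ← h]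
    · exact mul_le_mul_of_nonneg_left (hact i h) (hΔ0 i)
  have hWi : inner ℝ (x - y) W = -‖x - y‖ ^ 2 + ∑ i, Δ i * inner ℝ (x - y) (q i) := by
    simp only [W, inner_add_right, inner_sum, inner_smul_right]
    rw [← neg_sub x y, inner_neg_right, real_inner_self_eq_norm_sq]
  have hgap : 0 ≤ inner ℝ (x - y) (x - v) := by
    rw [inner_sub_right]
    linarith [hv x hxB]
  have hsq : ‖x - y‖ ^ 2 ≤ n * ‖x - y‖ * inner ℝ (x - y) (x - v) := by
    refine le_trans ?_ (mul_le_mul_of_nonneg_right hΔle hgap)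
    rw [inner_sub_right, mul_sub]
    linarith
  rcases (norm_nonneg (x - y)).eq_or_lt with h | h
  · rw [← h]
    positivity
  · nlinarith

/-! ### Gradient and weight vectors -/

theorem gradient_objective (xstar x : Vec n) : gradient (objective xstar) x = x - xstar := by
  refine HasGradientAt.gradient ?_
  rw [hasGradientAt_iff_hasFDerivAt]
  have h := (((hasFDerivAt_id (𝕜 := ℝ) x).sub_const xstar).norm_sq).const_mul (1 / 2 : ℝ)
  refine h.congr_fderiv ?_
  ext u
  simp

theorem inner_le_of_isLPSolution {xstar x p u : Vec n}
    (h : IsLPSolution (gradient (objective xstar) x) p) (hu : u ∈ birkhoff n) :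
    inner ℝ (x - xstar) p ≤ inner ℝ (x - xstar) u := by
  rw [gradient_objective] at h
  exact h.2 hu

theorem combine_add (p : ℕ → Vec n) (k : ℕ) (u w : Fin k → ℝ) :
    combine p k (u + w) = combine p k u + combine p k w := by
  simp [combine, add_smul, Finset.sum_add_distrib]

theorem combine_smul (p : ℕ → Vec n) (k : ℕ) (a : ℝ) (u : Fin k → ℝ) :
    combine p k (a • u) = a • combine p k u := by
  simp [combine, Finset.smul_sum, mul_smul]

theorem combine_single (p : ℕ → Vec n) (k : ℕ) (i : Fin k) (a : ℝ) :
    combine p k (Pi.single i a) = a • p (i + 1) := by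
  simp [combine, Pi.single_apply, ite_smul]

theorem combine_snoc (p : ℕ → Vec n) (k : ℕ) (u : Fin k → ℝ) (a : ℝ) :
    combine p (k + 1) (Fin.snoc u a : Fin (k + 1) → ℝ) = combine p k u + a • p (k + 1) := by
  simp [combine, Fin.sum_univ_castSucc]

theorem combine_congr {p p' : ℕ → Vec n} {k : ℕ} (h : ∀ i, 1 ≤ i → i ≤ k → p i = p' i)
    (u : Fin k → ℝ) : combine p k u = combine p' k u :=
  Finset.sum_congr rfl fun i _ => by rw [h (i + 1) (by omega) (by omega)]

/-- For small `t` the linear term dominates; this extracts first-order optimality from a comparison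
of squared norms. -/
theorem nonneg_of_forall_quadratic_nonneg {a b c : ℝ} (hb : 0 ≤ b) (hc : 0 < c)
    (h : ∀ t, 0 < t → t ≤ c → 0 ≤ 2 * t * a + t ^ 2 * b) : 0 ≤ a := by
  by_contra! ha
  have hb1 : 0 < b + 1 := by linarith
  have ht : 0 < min c (-a / (b + 1)) := lt_min hc (div_pos (neg_pos.2 ha) hb1)
  have h1 := h _ ht (min_le_left _ _)
  have h2 : min c (-a / (b + 1)) * (b + 1) ≤ -a :=
    (le_div_iff₀ hb1).1 (min_le_right _ _)
  nlinarith

/-! ### Decrease of the error along a run -/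

namespace IsRun

variable {xstar : Vec n} {tol : ℝ} {K : ℕ} {x p : ℕ → Vec n} {θ : (k : ℕ) → Fin k → ℝ}

theorem atom_mem_perms (h : IsRun xstar tol K x p θ) {k : ℕ} (hk : k < K) :
    p (k + 1) ∈ perms n :=
  (h.lp k hk).1

theorem iterate_mem_birkhoff (h : IsRun xstar tol K x p θ) {k : ℕ} (hk : k ≤ K) :
    x k ∈ birkhoff n := by
  rcases k with _ | k
  · exact perms_subset_birkhoff h.init
  · rw [h.iterate k hk]
    exact convex_birkhoff.sum_mem (fun i _ => (h.simplex k hk).1 i) (h.simplex k hk).2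
      fun i _ => perms_subset_birkhoff (h.atom_mem_perms (by omega))

theorem norm_iterate_sub_sq_le (h : IsRun xstar tol K x p θ) {k : ℕ} (hk : k < K)
    {u : Fin (k + 1) → ℝ} (hu : u ∈ stdSimplex ℝ (Fin (k + 1))) :
    ‖x (k + 1) - xstar‖ ^ 2 ≤ ‖combine p (k + 1) u - xstar‖ ^ 2 := by
  rw [h.iterate k hk]
  exact h.optimal k hk hu

/-- At a fully corrected iterate, no active atom lies above the iterate in the direction of the
gradient. -/
theorem inner_active_atom_le (h : IsRun xstar tol K x p θ) {k : ℕ} (hk : k < K)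
    (i : Fin (k + 1)) (hi : 0 < θ (k + 1) i) :
    inner ℝ (x (k + 1) - xstar) (p (i + 1)) ≤ inner ℝ (x (k + 1) - xstar) (x (k + 1)) := by
  have hs := h.simplex k hk
  suffices 0 ≤ inner ℝ (x (k + 1) - xstar) (x (k + 1) - p (i + 1)) by
    rw [inner_sub_right] at this
    linarith
  refine nonneg_of_forall_quadratic_nonneg (sq_nonneg ‖x (k + 1) - p (i + 1)‖) hi
    fun t ht hti => ?_
  -- Moving away from atom `i` keeps its weight nonnegative as long as `t ≤ θ i`.
  have hu : (1 + t) • θ (k + 1) + Pi.single i (-t) ∈ stdSimplex ℝ (Fin (k + 1)) := by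
    refine ⟨fun j => ?_, ?_⟩
    · have hj := hs.1 j
      rcases eq_or_ne j i with rfl | hji
      · simp only [Pi.add_apply, Pi.smul_apply, smul_eq_mul, Pi.single_eq_same]
        nlinarith
      · simp only [Pi.add_apply, Pi.smul_apply, smul_eq_mul, Pi.single_eq_of_ne hji]
        nlinarith
    · simp [Finset.sum_add_distrib, ← Finset.mul_sum, hs.2]
  have hle := h.norm_iterate_sub_sq_le hk hu
  rw [combine_add, combine_smul, combine_single, ← h.iterate k hk,
    show (1 + t) • x (k + 1) + -t • p (i + 1) - xstar
      = (x (k + 1) - xstar) + t • (x (k + 1) - p (i + 1)) by module,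
    norm_add_sq_real, inner_smul_right, norm_smul, mul_pow, Real.norm_eq_abs, sq_abs] at hle
  linarith

/-- The guaranteed decrease of the squared error in terms of the Frank-Wolfe gap. -/
theorem norm_sub_sq_le_sub_gap_sq (h : IsRun xstar tol K x p θ) (hstar : xstar ∈ birkhoff n)
    (hn : 0 < n) {k : ℕ} (hk : k + 1 < K) :
    ‖x (k + 2) - xstar‖ ^ 2 ≤ ‖x (k + 1) - xstar‖ ^ 2 -
      inner ℝ (x (k + 1) - xstar) (x (k + 1) - p (k + 2)) ^ 2 / (2 * n) := by
  set G : ℝ := inner ℝ (x (k + 1) - xstar) (x (k + 1) - p (k + 2)) with hG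
  have hn' : (0 : ℝ) < 2 * n := by positivity
  have hxB := h.iterate_mem_birkhoff hk.le
  have hpB := perms_subset_birkhoff (h.atom_mem_perms hk)
  have hD := norm_sub_sq_le_of_mem_birkhoff hxB hpB
  have hG0 : 0 ≤ G := by
    rw [hG, inner_sub_right]
    linarith [inner_le_of_isLPSolution (h.lp _ hk) hxB]
  have hGn : G ≤ 2 * n := by
    have h1 : G ≤ _ := real_inner_le_norm _ _
    have h2 := norm_sub_sq_le_of_mem_birkhoff hxB hstar
    nlinarith [sq_nonneg (‖x (k + 1) - xstar‖ - ‖x (k + 1) - p (k + 2)‖)]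
  -- Minimizer of the upper bound `-2γG + 2nγ²` on the change of the squared error.
  set γ : ℝ := G / (2 * n) with hγ
  have hγ0 : 0 ≤ γ := div_nonneg hG0 hn'.le
  have hγ1 : γ ≤ 1 := (div_le_one hn').2 hGn
  have hs := h.simplex k (by omega)
  have hu : (Fin.snoc ((1 - γ) • θ (k + 1)) γ : Fin (k + 2) → ℝ) ∈
      stdSimplex ℝ (Fin (k + 2)) := by
    refine ⟨fun j => ?_, ?_⟩
    · refine Fin.lastCases ?_ (fun j => ?_) j
      · simpa using hγ0
      · simpa using mul_nonneg (sub_nonneg.2 hγ1) (hs.1 j)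
    · simp [Fin.sum_univ_castSucc, ← Finset.mul_sum, hs.2]
  have hle := h.norm_iterate_sub_sq_le hk hu
  rw [combine_snoc, combine_smul, ← h.iterate k (by omega),
    show (1 - γ) • x (k + 1) + γ • p (k + 1 + 1) - xstar
      = (x (k + 1) - xstar) - γ • (x (k + 1) - p (k + 2)) by module,
    norm_sub_sq_real (x (k + 1) - xstar), inner_smul_right, norm_smul, mul_pow, Real.norm_eq_abs, sq_abs,
    ← hG] at hle
  have hγG : γ * (2 * n) = G := div_mul_cancel₀ _ hn'.ne'
  have hGγ : G ^ 2 / (2 * n) = γ * G := by rw [hγ]; ring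
  have hγD : γ ^ 2 * ‖x (k + 1) - p (k + 2)‖ ^ 2 ≤ γ ^ 2 * (2 * n) :=
    mul_le_mul_of_nonneg_left hD (sq_nonneg _)
  have hγ2 : γ ^ 2 * (2 * n) = γ * G := by rw [← hγG]; ring
  rw [hGγ]
  change ‖x (k + 2) - xstar‖ ^ 2 ≤ _ at hle
  linarith

/-- Linear convergence of the fully corrected iterates. -/
theorem norm_sub_sq_le_contraction (h : IsRun xstar tol K x p θ) (hstar : xstar ∈ birkhoff n)
    (hn : 0 < n) {k : ℕ} (hk : k + 1 < K) :
    ‖x (k + 2) - xstar‖ ^ 2 ≤ ‖x (k + 1) - xstar‖ ^ 2 * (1 - 1 / (2 * n ^ 3)) := by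
  have hn' : (0 : ℝ) < n := by positivity
  have hgap : ‖x (k + 1) - xstar‖ ≤ n * inner ℝ (x (k + 1) - xstar) (x (k + 1) - p (k + 2)) :=
    norm_sub_le_mul_gap hstar (q := fun i : Fin (k + 1) => p (i + 1))
      (fun i => h.atom_mem_perms (by omega)) (h.simplex k (by omega)) (h.iterate k (by omega))
      (fun u hu => inner_le_of_isLPSolution (h.lp _ hk) hu)
      (h.inner_active_atom_le (by omega))
  refine (h.norm_sub_sq_le_sub_gap_sq hstar hn hk).trans ?_
  have hsq := pow_le_pow_left₀ (norm_nonneg _) hgap 2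
  have : ‖x (k + 1) - xstar‖ ^ 2 * (1 / (2 * n ^ 3)) ≤
      inner ℝ (x (k + 1) - xstar) (x (k + 1) - p (k + 2)) ^ 2 / (2 * n) := by
    rw [mul_one_div, div_le_div_iff₀ (by positivity) (by positivity)]
    nlinarith
  linarith

/-- By convexity the gap dominates the squared error `t`, and `t - t²/(2n)` is at most `n/2`,
whatever `t` is. -/
theorem norm_two_sub_sq_le (h : IsRun xstar tol K x p θ) (hstar : xstar ∈ birkhoff n)
    (hn : 0 < n) (hK : 1 < K) : ‖x 2 - xstar‖ ^ 2 ≤ n / 2 := by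
  have hn' : (0 : ℝ) < n := by positivity
  have hgap : ‖x 1 - xstar‖ ^ 2 ≤ inner ℝ (x 1 - xstar) (x 1 - p 2) := by
    have h1 := inner_le_of_isLPSolution (h.lp 1 hK) hstar
    rw [← real_inner_self_eq_norm_sq, inner_sub_right, inner_sub_right]
    linarith
  refine (h.norm_sub_sq_le_sub_gap_sq hstar hn (k := 0) hK).trans ?_
  have hsq := pow_le_pow_left₀ (sq_nonneg _) hgap 2
  simp only [zero_add]
  rw [sub_le_iff_le_add, ← sub_le_iff_le_add', le_div_iff₀ (by positivity)]
  nlinarith [sq_nonneg (‖x 1 - xstar‖ ^ 2 - n)]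

theorem norm_sub_sq_le_exp (h : IsRun xstar tol K x p θ) (hstar : xstar ∈ birkhoff n)
    (hn : 0 < n) (k : ℕ) (hk : k + 2 ≤ K) :
    ‖x (k + 2) - xstar‖ ^ 2 ≤ n / 2 * Real.exp (-(k / (8 * n ^ 3))) := by
  have hn' : (0 : ℝ) < n := by positivity
  induction k with
  | zero => simpa using h.norm_two_sub_sq_le hstar hn (by omega)
  | succ k ih =>
    -- The rate is weakened here to the constant `8` of the final bound.
    have h1 : (1 : ℝ) / (8 * n ^ 3) ≤ 1 / (2 * n ^ 3) := by
      gcongr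
      norm_num
    have h2 := Real.add_one_le_exp (-(1 / (8 * (n : ℝ) ^ 3)))
    calc ‖x (k + 1 + 2) - xstar‖ ^ 2
        ≤ ‖x (k + 2) - xstar‖ ^ 2 * (1 - 1 / (2 * n ^ 3)) :=
          h.norm_sub_sq_le_contraction hstar hn (k := k + 1) (by omega)
      _ ≤ ‖x (k + 2) - xstar‖ ^ 2 * Real.exp (-(1 / (8 * n ^ 3))) := by gcongr; linarith
      _ ≤ n / 2 * Real.exp (-(k / (8 * n ^ 3))) * Real.exp (-(1 / (8 * n ^ 3))) := by
          gcongr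
          exact ih (by omega)
      _ = _ := by
          rw [mul_assoc, ← Real.exp_add]
          congr 2
          push_cast
          ring

/-- The initial point and the first atom cannot both be far from the target. -/
theorem norm_zero_sub_sq_add_norm_one_sub_sq_le (h : IsRun xstar tol K x p θ)
    (hstar : xstar ∈ birkhoff n) (hK : 0 < K) :
    ‖x 0 - xstar‖ ^ 2 + ‖x 1 - xstar‖ ^ 2 ≤ 2 * n := by
  have hx1 : x 1 = p 1 := by
    have h1 := (h.simplex 0 hK).2
    rw [h.iterate 0 hK, combine]
    simp at h1 ⊢
    simp [h1]
  have hx0B := h.iterate_mem_birkhoff (Nat.zero_le K)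
  have hx1B := h.iterate_mem_birkhoff (k := 1) hK
  have hlp := inner_le_of_isLPSolution (h.lp 0 hK) hstar
  rw [zero_add, ← hx1, inner_sub_left, inner_sub_left, real_inner_self_eq_norm_sq,
    real_inner_comm] at hlp
  rw [norm_sub_sq_real, norm_sub_sq_real]
  have h3 := inner_nonneg_of_mem_birkhoff hx1B hx0B
  have h4 := real_inner_comm xstar (x 1)
  linarith [norm_sq_le_of_mem_birkhoff hx0B, norm_sq_le_of_mem_birkhoff hx1B]

theorem dim_pos (h : IsRun xstar tol K x p θ) (htol : 0 ≤ tol) (hK : 0 < K) : 0 < n := by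
  rcases Nat.eq_zero_or_pos n with rfl | hn
  · have h1 := h.guard 0 hK
    rw [Subsingleton.elim (x 0 - xstar) 0, norm_zero] at h1
    linarith
  · exact hn

theorem isApproxDecomposition (h : IsRun xstar tol K x p θ) (hK : 1 ≤ K) :
    IsApproxDecomposition xstar ‖x K - xstar‖
      (Finset.univ.filter fun i : Fin K => 0 < θ K i) (fun i => p (i + 1)) (θ K) := by
  obtain ⟨k, rfl⟩ := Nat.exists_eq_add_of_le' hK
  have hs := h.simplex k (by omega)
  refine ⟨fun i _ => h.atom_mem_perms i.2, fun i hi => (Finset.mem_filter.1 hi).2, ?_, ?_⟩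
  · rw [← hs.2]
    exact Finset.sum_le_sum_of_subset_of_nonneg (Finset.filter_subset _ _) fun i _ _ => hs.1 i
  · rw [Finset.sum_filter_of_ne, h.iterate k (by omega), norm_sub_rev]
    · rfl
    · intro i _ hi
      exact (hs.1 i).lt_of_ne fun h0 => hi (by simp [← h0])

end IsRun

/-! ### From error bounds to iteration counts -/

/-- Passing from `n/2` to `2n` leaves a factor `4 ≥ e` inside the logarithm. It is worth `8n³ ≥ 8`
iterations and absorbs the index shifts. -/
theorem add_le_mul_log_of_sq_le {n : ℕ} (hn : 0 < n) {ε m : ℝ} (hε : 0 < ε)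
    (h : ε ^ 2 ≤ n / 2 * Real.exp (-(m / (8 * n ^ 3)))) :
    m + 8 ≤ 8 * (n : ℝ) ^ 3 * Real.log (2 * n / ε ^ 2) := by
  have hn' : (1 : ℝ) ≤ n := by exact_mod_cast hn
  have hn3 : (1 : ℝ) ≤ n ^ 3 := one_le_pow₀ hn'
  have hle : Real.exp (1 + m / (8 * n ^ 3)) ≤ 2 * n / ε ^ 2 := by
    rw [le_div_iff₀ (by positivity), Real.exp_add]
    have he : Real.exp 1 ≤ 4 := by linarith [Real.exp_one_lt_d9]
    calc Real.exp 1 * Real.exp (m / (8 * n ^ 3)) * ε ^ 2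
        ≤ 4 * Real.exp (m / (8 * n ^ 3)) * (n / 2 * Real.exp (-(m / (8 * n ^ 3)))) := by gcongr
      _ = 2 * n * (Real.exp (m / (8 * n ^ 3)) * Real.exp (-(m / (8 * n ^ 3)))) := by ring
      _ = 2 * n := by rw [← Real.exp_add, add_neg_cancel, Real.exp_zero, mul_one]
  have hlog := (Real.le_log_iff_exp_le (by positivity)).2 hle
  calc m + 8 ≤ 8 * (n : ℝ) ^ 3 * (1 + m / (8 * n ^ 3)) := by
        rw [mul_add, mul_div_cancel₀ _ (by positivity)]
        linarith
    _ ≤ _ := by gcongr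

theorem two_le_mul_log_of_sq_le {n : ℕ} (hn : 0 < n) {ε : ℝ} (hε : 0 < ε) (h : ε ^ 2 ≤ n) :
    2 ≤ 8 * (n : ℝ) ^ 3 * Real.log (2 * n / ε ^ 2) := by
  have hn' : (1 : ℝ) ≤ n := by exact_mod_cast hn
  have hn3 : (1 : ℝ) ≤ n ^ 3 := one_le_pow₀ hn'
  have hlog : Real.log 2 ≤ Real.log (2 * n / ε ^ 2) := by
    refine Real.log_le_log (by norm_num) ?_
    rw [le_div_iff₀ (by positivity)]
    linarith
  nlinarith [Real.log_two_gt_d9]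

namespace IsRun

variable {xstar : Vec n} {tol : ℝ} {K : ℕ} {x p : ℕ → Vec n} {θ : (k : ℕ) → Fin k → ℝ}

theorem length_le_of_error_pos (h : IsRun xstar tol K x p θ) (htol : 0 ≤ tol)
    (hstar : xstar ∈ birkhoff n) (hpos : 0 < ‖x K - xstar‖)
    (hone : K = 1 → ‖x 1 - xstar‖ ≤ ‖x 0 - xstar‖) :
    (K : ℝ) ≤ 8 * (n : ℝ) ^ 3 * Real.log (2 * n / ‖x K - xstar‖ ^ 2) := by
  match K, h, hpos, hone with
  | 0, h, hpos, _ =>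
    have hd := norm_sub_sq_le_of_mem_birkhoff (h.iterate_mem_birkhoff le_rfl) hstar
    have hlog : 0 ≤ Real.log (2 * n / ‖x 0 - xstar‖ ^ 2) :=
      Real.log_nonneg ((one_le_div (by positivity)).2 hd)
    rw [Nat.cast_zero]
    positivity
  | 1, h, hpos, hone =>
    -- The smaller of two squared errors with sum at most `2n` is at most `n`.
    have hsum := h.norm_zero_sub_sq_add_norm_one_sub_sq_le hstar one_pos
    have hle := pow_le_pow_left₀ (norm_nonneg _) (hone rfl) 2
    have := two_le_mul_log_of_sq_le (h.dim_pos htol one_pos) hpos (by linarith)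
    rw [Nat.cast_one]
    linarith
  | k + 2, h, hpos, _ =>
    have hn := h.dim_pos htol (by omega)
    have := add_le_mul_log_of_sq_le hn hpos (h.norm_sub_sq_le_exp hstar hn k le_rfl)
    push_cast
    linarith

theorem length_le_of_tolerance_pos (h : IsRun xstar tol K x p θ) (htol : 0 < tol)
    (hstar : xstar ∈ birkhoff n) :
    (K : ℝ) ≤ max 1 (8 * (n : ℝ) ^ 3 * Real.log (2 * n / tol ^ 2)) := by
  match K, h with
  | 0, _ => simp
  | 1, _ => simp
  | 2, h =>
    have hsum := h.norm_zero_sub_sq_add_norm_one_sub_sq_le hstar two_pos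
    have h0 := pow_le_pow_left₀ htol.le (h.guard 0 (by omega)).le 2
    have h1 := pow_le_pow_left₀ htol.le (h.guard 1 (by omega)).le 2
    refine le_max_of_le_right ?_
    exact_mod_cast two_le_mul_log_of_sq_le (h.dim_pos htol.le two_pos) htol (by linarith)
  -- The guard speaks of `x (k + 2)`, the last iterate known to exceed the tolerance, so the shift
  -- is `3`.
  | k + 3, h =>
    have hn := h.dim_pos htol.le (by omega)
    have h1 := pow_le_pow_left₀ htol.le (h.guard (k + 2) (by omega)).le 2
    have := add_le_mul_log_of_sq_le hn htol
      (h1.trans (h.norm_sub_sq_le_exp hstar hn k (by omega)))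
    refine le_max_of_le_right ?_
    push_cast
    linarith

end IsRun

/-! ### Existence of runs -/

/-- By Birkhoff's theorem the best permutation is optimal over the whole polytope. -/
theorem exists_isLPSolution (c : Vec n) : ∃ v, IsLPSolution c v := by
  obtain ⟨σ, hσ⟩ := Finite.exists_min
    fun σ : Equiv.Perm (Fin n) => inner ℝ c (vec (σ.permMatrix ℝ))
  refine ⟨_, ⟨σ, rfl⟩, ?_⟩
  rintro _ ⟨X, hX, rfl⟩
  obtain ⟨w, hw0, hw1, rfl⟩ := exists_eq_sum_perm_of_mem_doublyStochastic hX
  have hvec : vec (∑ τ, w τ • τ.permMatrix ℝ) = ∑ τ, w τ • vec (τ.permMatrix ℝ) := by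
    ext e
    simp [vec, Matrix.sum_apply]
  simp only [Set.mem_ofPred_eq, hvec, inner_sum, inner_smul_right]
  calc inner ℝ c (vec (σ.permMatrix ℝ))
      = ∑ τ, w τ * inner ℝ c (vec (σ.permMatrix ℝ)) := by rw [← Finset.sum_mul, hw1, one_mul]
    _ ≤ _ := Finset.sum_le_sum fun τ _ => mul_le_mul_of_nonneg_left (hσ τ) (hw0 τ)

theorem exists_optimal_weights (xstar : Vec n) (p : ℕ → Vec n) (k : ℕ) :
    ∃ t ∈ stdSimplex ℝ (Fin (k + 1)),
      IsMinOn (fun u : Fin (k + 1) → ℝ => ‖combine p (k + 1) u - xstar‖ ^ 2)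
        (stdSimplex ℝ (Fin (k + 1))) t := by
  refine (isCompact_stdSimplex ℝ (Fin (k + 1))).exists_isMinOn
    ⟨_, single_mem_stdSimplex ℝ 0⟩ (Continuous.continuousOn ?_)
  unfold combine
  fun_prop

theorem IsRun.exists_extend {xstar : Vec n} {tol : ℝ} {K : ℕ} {x p : ℕ → Vec n}
    {θ : (k : ℕ) → Fin k → ℝ} (h : IsRun xstar tol K x p θ) (hK : tol < ‖x K - xstar‖) :
    ∃ (x' p' : ℕ → Vec n) (θ' : (k : ℕ) → Fin k → ℝ),
      IsRun xstar tol (K + 1) x' p' θ' ∧ x' 0 = x 0 := by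
  obtain ⟨v, hv⟩ := exists_isLPSolution (gradient (objective xstar) (x K))
  set p' := Function.update p (K + 1) v with hp'
  obtain ⟨t, ht, hmin⟩ := exists_optimal_weights xstar p' K
  set θ' := Function.update θ (K + 1) t with hθ'
  set x' := Function.update x (K + 1) (combine p' (K + 1) t) with hx'
  have hpold : ∀ k, k ≤ K → p' k = p k := fun k hk => Function.update_of_ne (by omega) _ _
  have hxold : ∀ k, k ≤ K → x' k = x k := fun k hk => Function.update_of_ne (by omega) _ _
  have hθold : ∀ k, k ≤ K → θ' k = θ k := fun k hk => Function.update_of_ne (by omega) _ _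
  have hpnew : p' (K + 1) = v := Function.update_self ..
  have hxnew : x' (K + 1) = combine p' (K + 1) t := Function.update_self ..
  have hθnew : θ' (K + 1) = t := Function.update_self ..
  have hcomb : ∀ k, k ≤ K → ∀ u, combine p' k u = combine p k u := fun k hk u =>
    combine_congr (fun i _ hi => hpold i (hi.trans hk)) u
  refine ⟨x', p', θ', ⟨?_, fun k hk => ?_, fun k hk => ?_, fun k hk => ?_, fun k hk => ?_,
    fun k hk => ?_⟩, hxold 0 (Nat.zero_le _)⟩
  · rw [hxold 0 (Nat.zero_le _)]
    exact h.init
  all_goals rcases (Nat.lt_succ_iff.1 hk).eq_or_lt with rfl | hlt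
  · rwa [hxold k le_rfl]
  · rw [hxold k hlt.le]
    exact h.guard k hlt
  · rwa [hxold k le_rfl, hpnew]
  · rw [hxold k hlt.le, hpold _ hlt]
    exact h.lp k hlt
  · rwa [hθnew]
  · rw [hθold _ hlt]
    exact h.simplex k hlt
  · rwa [hθnew]
  · rw [hθold _ hlt]
    simp only [hcomb _ hlt]
    exact h.optimal k hlt
  · rw [hxnew, hθnew]
  · rw [hxold _ hlt, hθold _ hlt, hcomb _ hlt]
    exact h.iterate k hlt

theorem exists_isRun_error_le {xstar x₀ : Vec n} (hstar : xstar ∈ birkhoff n) {ε : ℝ}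
    (hε : 0 < ε) (hx₀ : x₀ ∈ perms n) :
    ∃ (K : ℕ) (x p : ℕ → Vec n) (θ : (k : ℕ) → Fin k → ℝ),
      IsRun xstar ε K x p θ ∧ x 0 = x₀ ∧ ‖x K - xstar‖ ≤ ε := by
  -- If no run reached the tolerance, every run could be extended, giving runs longer than the bound
  -- allows.
  by_contra! hcon
  have hall : ∀ K : ℕ, ∃ (x p : ℕ → Vec n) (θ : (k : ℕ) → Fin k → ℝ),
      IsRun xstar ε K x p θ ∧ x 0 = x₀ := by
    intro K
    induction K with
    | zero =>
      refine ⟨fun _ => x₀, fun _ => x₀, fun _ _ => 0, ⟨hx₀, ?_, ?_, ?_, ?_, ?_⟩, rfl⟩ <;>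
        exact fun k hk => absurd hk (Nat.not_lt_zero k)
    | succ K ih =>
      obtain ⟨x, p, θ, h, h0⟩ := ih
      obtain ⟨x', p', θ', h', h0'⟩ := h.exists_extend (hcon K x p θ h h0)
      exact ⟨x', p', θ', h', h0'.trans h0⟩
  obtain ⟨K, hK⟩ := exists_nat_gt (max 1 (8 * (n : ℝ) ^ 3 * Real.log (2 * n / ε ^ 2)))
  obtain ⟨x, p, θ, h, -⟩ := hall K
  exact absurd (h.length_le_of_tolerance_pos hε hstar) (not_le.2 hK)

end FCFW

theorem mainTheorem5 (n : ℕ) (xstar : FCFW.Vec n) (hxstar : xstar ∈ FCFW.birkhoff n) :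
    -- error attained after `K` iterations, for every run
    (∀ (tol : ℝ) (K : ℕ) (x p : ℕ → FCFW.Vec n) (θ : (k : ℕ) → Fin k → ℝ),
      0 ≤ tol → FCFW.IsRun xstar tol K x p θ →
        (1 ≤ K → FCFW.IsApproxDecomposition xstar ‖x K - xstar‖
          (Finset.univ.filter fun i : Fin K => 0 < θ K i) (fun i => p (i + 1)) (θ K)) ∧
        (0 < ‖x K - xstar‖ → (K = 1 → ‖x 1 - xstar‖ ≤ ‖x 0 - xstar‖) →
          (K : ℝ) ≤ 8 * (n : ℝ) ^ 3 * Real.log (2 * n / ‖x K - xstar‖ ^ 2))) ∧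
    -- a prescribed tolerance `ε` is attained, and every run has few iterations
    (∀ ε : ℝ, 0 < ε →
      (∀ x₀ ∈ FCFW.perms n, ∃ (K : ℕ) (x p : ℕ → FCFW.Vec n) (θ : (k : ℕ) → Fin k → ℝ),
        FCFW.IsRun xstar ε K x p θ ∧ x 0 = x₀ ∧ ‖x K - xstar‖ ≤ ε) ∧
      (∀ (K : ℕ) (x p : ℕ → FCFW.Vec n) (θ : (k : ℕ) → Fin k → ℝ),
        FCFW.IsRun xstar ε K x p θ →
          (K : ℝ) ≤ max 1 (8 * (n : ℝ) ^ 3 * Real.log (2 * n / ε ^ 2)))) := by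
  refine ⟨fun tol K x p θ htol h => ⟨h.isApproxDecomposition, fun hpos hone =>
    h.length_le_of_error_pos htol hxstar hpos hone⟩, fun ε hε => ⟨fun x₀ hx₀ =>
    FCFW.exists_isRun_error_le hxstar hε hx₀, fun K x p θ h =>
    h.length_le_of_tolerance_pos hε hxstar⟩⟩
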